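/- \textbf{Setting.} Let $\hat a,\hat b,\hat c,\hat d,\hat e,\hat f\in\mathbb C$ with $\hat a\hat c\neq0$ and $\lambda\tau\neq 0$, where $\lambda=\hat b^2-\hat a\hat c$ and $\tau=\big((\hat b^2-\hat a\hat c)(\hat d^2-\hat a\hat f)-(\hat b\hat d-\hat a\hat e)^2\big)/\hat a$. Let $y_1,y_2$ be the two roots, as formal Laurent series in $1/x$ over $\mathbb C$, of $$\hat a y^2+2\hat b xy+\hat c x^2+2\hat d y+2\hat e x+\hat f=0 ,$$ i.e. $y_1+y_2=-2(\hat bx+\hat d)/\hat a$ and $y_1y_2=(\hat cx^2+2\hat ex+\hat f)/\hat a$. For a formal Laurent series $f$ in $1/x$ put $\mathbb E_jf=f(y_j)$ $(j=1,2)$, $\Delta_y=y_2-y_1$, $\mathbb Df=(\mathbb E_2f-\mathbb E_1f)/\Delta_y$, $\mathbb Mf=(\mathbb E_1f+\mathbb E_2f)/2$. Let $S(x)=\sum_{n\ge0}u_nx^{-n-1}$ be a formal Stieltjes function with $u_0=1$ and $\det[u_{i+j}]_{i,j=0}^n\ne0$ for all $n\ge0$. Let $P_n$ $(n\ge 0)$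 be its monic orthogonal polynomial of degree $n$ and $P^{(1)}_{n-1}$ the associated polynomial of the first kind, i.e. the denominator and numerator of the diagonal Pad\'e approximant, determined by $S-P^{(1)}_{n-1}/P_n=\mathcal O(x^{-2n-1})$ as $x\to\infty$ (so $P^{(1)}_{-1}=0$, $P^{(1)}_0=1$). Let $q_{-1}=1$ and $q_n=P_nS-P^{(1)}_{n-1}$ for $n\ge0$ be the functions of the second kind. \textbf{Theorem.} Let $A,B,C,D\in\mathbb C[x]$. The following statements are equivalent. (a) $S$ satisfies the Riccati equation $A\,\mathbb DS=B\,\mathbb E_1S\,\mathbb E_2S+C\,\mathbb MS+D$. (b) There are polynomials $l_n,\pi_n,\Theta_n$ in $x$, of uniformly bounded degrees, such that for all $n\ge1$ $$A\,\mathbb DP_n=(l_{n-1}+\Delta_y\pi_{n-1})\mathbb E_1P_n-\tfrac C2\,\mathbb E_2P_n-B\,\mathbb E_2P^{(1)}_{n-1}+\Theta_{n-1}\mathbb E_1P_{n-1},$$ $$A\,\mathbb DP^{(1)}_{n-1}=(l_{n-1}+\Delta_y\pi_{n-1})\mathbb E_1P^{(1)}_{n-1}+\tfrac C2\,\mathbb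 E_2P^{(1)}_{n-1}+D\,\mathbb E_2P_n+\Theta_{n-1}\mathbb E_1P^{(1)}_{n-2}.$$ (c) There are polynomials $l_n,\pi_n,\Theta_n$ $(n\ge-1)$ in $x$, of uniformly bounded degrees, with $l_{-1}=C/2$, $\pi_{-1}=0$, $\Theta_{-1}=D$, such that for all $n\ge0$ $$A\,\mathbb Dq_n=(l_{n-1}+\Delta_y\pi_{n-1})\mathbb E_1q_n+\big(B\,\mathbb E_1S+\tfrac C2\big)\mathbb E_2q_n+\Theta_{n-1}\mathbb E_1q_{n-1}.$$ Moreover, if polynomials $l_n,\pi_n,\Theta_n$ of uniformly bounded degrees satisfy the relations in (b) and are extended to $n=-1$ by $l_{-1}=C/2$, $\pi_{-1}=0$, $\Theta_{-1}=D$, then the relation in (c) holds for all $n\ge0$ with these same polynomials. -/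

import Mathlib

open Polynomial

noncomputable section

namespace LaguerreHahn

/-- The independent variable `x`. Elements of `LaurentSeries ℂ` are read as formal Laurent series
at infinity: the formal variable of `LaurentSeries ℂ` is `1/x`, so that `x` has order `-1`, and the
coefficient of index `k` is the coefficient of `x ^ (-k)`. -/
def xVar : LaurentSeries ℂ := HahnSeries.single (-1) 1

/-- A polynomial in `x`, as a Laurent series at infinity. -/
def ofPoly (p : ℂ[X]) : LaurentSeries ℂ := aeval xVar p

/-- Composition `f ↦ f(y)`: if `f = ∑ k, a k * x ^ (-k)` then `substAtInfinity y f = ∑ k, a k * y ^ (-k)`.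
It is meant for `y` of negative order (that is, `y → ∞` as `x → ∞`). We write
`f = x ^ (-m) * g` with `m` the order of `f` and `g` a power series in `1/x`. -/
def substAtInfinity (y f : LaurentSeries ℂ) : LaurentSeries ℂ :=
  (y⁻¹) ^ f.order * PowerSeries.heval y⁻¹ f.powerSeriesPart

/-- A (general, `q`-quadratic) non-uniform lattice: the two roots `y₁, y₂` of
`a y² + 2 b x y + c x² + 2 d y + 2 e x + f = 0`, as formal series in `x`, where `a c ≠ 0` and
`λ τ ≠ 0` for `λ = b² - a c`, `τ = ((b² - a c) (d² - a f) - (b d - a e)²) / a`. -/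
structure Lattice where
  (a b c d e f : ℂ)
  a_ne_zero : a ≠ 0
  c_ne_zero : c ≠ 0
  lambda_ne_zero : b ^ 2 - a * c ≠ 0
  tau_ne_zero : ((b ^ 2 - a * c) * (d ^ 2 - a * f) - (b * d - a * e) ^ 2) / a ≠ 0
  (y₁ y₂ : LaurentSeries ℂ)
  sum_eq : y₁ + y₂ = ofPoly (C (-2 / a) * (C b * X + C d))
  prod_eq : y₁ * y₂ = ofPoly (C (1 / a) * (C c * X ^ 2 + C (2 * e) * X + C f))

namespace Lattice

variable (Λ : Lattice)

/-- `𝔼₁ f = f(y₁)`. -/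
def E₁ (f : LaurentSeries ℂ) : LaurentSeries ℂ := substAtInfinity Λ.y₁ f

/-- `𝔼₂ f = f(y₂)`. -/
def E₂ (f : LaurentSeries ℂ) : LaurentSeries ℂ := substAtInfinity Λ.y₂ f

/-- `Δ_y = y₂ - y₁`. -/
def Δy : LaurentSeries ℂ := Λ.y₂ - Λ.y₁

/-- The divided difference operator `𝔻 f = (f(y₂) - f(y₁)) / (y₂ - y₁)`. -/
def D (f : LaurentSeries ℂ) : LaurentSeries ℂ := (Λ.E₂ f - Λ.E₁ f) / Λ.Δy

/-- The mean operator `𝕄 f = (f(y₁) + f(y₂)) / 2`. -/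
def M (f : LaurentSeries ℂ) : LaurentSeries ℂ := (Λ.E₁ f + Λ.E₂ f) / 2

end Lattice

/-- The formal Stieltjes function `S(x) = ∑ n, u n * x ^ (-n-1)`. -/
def stieltjes (u : ℕ → ℂ) : LaurentSeries ℂ :=
  HahnSeries.ofPowerSeries ℤ ℂ (PowerSeries.X * PowerSeries.mk u)

/-- Admissible moments: `u 0 = 1` and all Hankel determinants are nonzero. -/
def RegularMoments (u : ℕ → ℂ) : Prop :=
  u 0 = 1 ∧ ∀ n : ℕ, (Matrix.of fun i j : Fin (n + 1) => u (i + j)).det ≠ 0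

/-- `P n` is the monic orthogonal polynomial of degree `n` of the Stieltjes function with
moments `u`, and `N n` is the associated polynomial of the first kind `P_{n-1}^{(1)}`
(so `N 0 = P_{-1}^{(1)} = 0`): they are the denominator and the numerator of the diagonal Padé
approximants, `S - P_{n-1}^{(1)} / P_n = O(x ^ (-2n-1))` as `x → ∞`. -/
def IsPadeSequence (u : ℕ → ℂ) (P N : ℕ → ℂ[X]) : Prop :=
  ∀ n : ℕ, (P n).Monic ∧ (P n).natDegree = n ∧
    ∀ k : ℤ, k < 2 * n + 1 → (stieltjes u - ofPoly (N n) / ofPoly (P n)).coeff k = 0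

/-- The functions of the second kind, with index shifted by one: `secondKind u P N n = q_{n-1}`,
where `q_{-1} = 1` and `q_n = P_n S - P_{n-1}^{(1)}` for `n ≥ 0` (in particular `q_0 = S`). -/
def secondKind (u : ℕ → ℂ) (P N : ℕ → ℂ[X]) : ℕ → LaurentSeries ℂ
  | 0 => 1
  | n + 1 => ofPoly (P n) * stieltjes u - ofPoly (N n)

/-- The Riccati equation `A 𝔻S = B 𝔼₁S 𝔼₂S + C 𝕄S + D`. -/
def Riccati (Λ : Lattice) (A B C D : ℂ[X]) (S : LaurentSeries ℂ) : Prop :=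
  ofPoly A * Λ.D S = ofPoly B * Λ.E₁ S * Λ.E₂ S + ofPoly C * Λ.M S + ofPoly D

/-- The polynomials of the sequences `l, π, Θ` have uniformly bounded degrees. -/
def UniformlyBoundedDegrees (l π Θ : ℕ → ℂ[X]) : Prop :=
  ∃ m : ℕ, ∀ n : ℕ, (l n).natDegree ≤ m ∧ (π n).natDegree ≤ m ∧ (Θ n).natDegree ≤ m

/-- The difference relations, for all `n ≥ 1`, for `P_n` and `P_{n-1}^{(1)} = N n`. Here
`l n, π n, Θ n` stand for `l_{n-1}, π_{n-1}, Θ_{n-1}`. -/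
def StructureRelations (Λ : Lattice) (A B C D : ℂ[X]) (P N l π Θ : ℕ → ℂ[X]) : Prop :=
  ∀ n : ℕ, 1 ≤ n →
    ofPoly A * Λ.D (ofPoly (P n)) =
        (ofPoly (l n) + Λ.Δy * ofPoly (π n)) * Λ.E₁ (ofPoly (P n))
          - ofPoly C / 2 * Λ.E₂ (ofPoly (P n)) - ofPoly B * Λ.E₂ (ofPoly (N n))
          + ofPoly (Θ n) * Λ.E₁ (ofPoly (P (n - 1))) ∧
    ofPoly A * Λ.D (ofPoly (N n)) =
        (ofPoly (l n) + Λ.Δy * ofPoly (π n)) * Λ.E₁ (ofPoly (N n))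
          + ofPoly C / 2 * Λ.E₂ (ofPoly (N n)) + ofPoly D * Λ.E₂ (ofPoly (P n))
          + ofPoly (Θ n) * Λ.E₁ (ofPoly (N (n - 1)))

/-- The difference relation, for all `n ≥ 0`, for the functions of the second kind
(`Q (n + 1)` is `q_n`, `Q n` is `q_{n-1}`). Here `l n, π n, Θ n` stand for
`l_{n-1}, π_{n-1}, Θ_{n-1}`. -/
def SecondKindRelation (Λ : Lattice) (A B C : ℂ[X]) (S : LaurentSeries ℂ)
    (Q : ℕ → LaurentSeries ℂ) (l π Θ : ℕ → ℂ[X]) : Prop :=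
  ∀ n : ℕ,
    ofPoly A * Λ.D (Q (n + 1)) =
        (ofPoly (l n) + Λ.Δy * ofPoly (π n)) * Λ.E₁ (Q (n + 1))
          + (ofPoly B * Λ.E₁ S + ofPoly C / 2) * Λ.E₂ (Q (n + 1))
          + ofPoly (Θ n) * Λ.E₁ (Q n)

/-- The initial conditions `l_{-1} = C/2`, `π_{-1} = 0`, `Θ_{-1} = D`. -/
def InitialConditions (C D : ℂ[X]) (l π Θ : ℕ → ℂ[X]) : Prop :=
  l 0 = Polynomial.C (1 / 2) * C ∧ π 0 = 0 ∧ Θ 0 = D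

end LaguerreHahn

end

/-! Write R for the difference of the two sides of the Riccati equation at `S`. Insert the Padé
fraction N_n/P_n instead and clear denominators: this gives a quantity symmetric in y₁, y₂, hence a
polynomial (`exists_clearedDefect_eq_ofPoly`). By `riccati_defect_eq` it equals E₁P_n E₂P_n R minus
an increment, which has bounded degree because q_n = O(x^(-n-1)) offsets P_n, N_n = O(x^n).

From (b) to (a): eliminating l + Δ_y π between the two relations leaves Θ times the Casorati
constant as cleared defect. Hence E₁P_n E₂P_n R has bounded degree for all n, which forces R = 0.

From (a) to (b): R = 0 makes the cleared defects polynomials of bounded degree. For each n the two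
relations form a linear system in l + Δ_y π and Θ whose determinant is the nonzero Casorati constant
(`IsPadeSequence.exists_casorati`). Cramer's rule gives a solution in ℂ[x] + Δ_y ℂ[x], and
conjugation y₁ ↔ y₂ separates l from π and bounds both.

Given (a), the relation in (c) for n ≥ 1 is a linear combination of the two in (b) and the Riccati
equation; for n = 0 it is the Riccati equation itself. -/

noncomputable section

namespace LaguerreHahn

/-! ### Orders of vanishing at infinity, and polynomials as Laurent series. -/

/-- `f = O(x ^ (-k))` as `x → ∞`. -/
def VanishesTo (k : ℤ) (f : LaurentSeries ℂ) : Prop := ∀ j < k, f.coeff j = 0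

namespace VanishesTo

variable {k m : ℤ} {f g : LaurentSeries ℂ}

theorem mono (hf : VanishesTo k f) (h : m ≤ k) : VanishesTo m f :=
  fun j hj => hf j (hj.trans_le h)

theorem add (hf : VanishesTo k f) (hg : VanishesTo k g) : VanishesTo k (f + g) :=
  fun j hj => by rw [HahnSeries.coeff_add, hf j hj, hg j hj, add_zero]

theorem neg (hf : VanishesTo k f) : VanishesTo k (-f) :=
  fun j hj => by rw [HahnSeries.coeff_neg, hf j hj, neg_zero]

theorem sub (hf : VanishesTo k f) (hg : VanishesTo k g) : VanishesTo k (f - g) := by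
  rw [sub_eq_add_neg]
  exact hf.add hg.neg

theorem mul (hf : VanishesTo k f) (hg : VanishesTo m g) : VanishesTo (k + m) (f * g) := by
  intro j hj
  rw [HahnSeries.coeff_mul]
  refine Finset.sum_eq_zero fun p hp => ?_
  have h := (Finset.mem_antidiagonal.1 hp).2.2
  rcases lt_or_ge p.1 k with h1 | h1
  · rw [hf _ h1, zero_mul]
  · rw [hg _ (by omega), mul_zero]

theorem one : VanishesTo 0 1 := by
  intro j hj
  rw [HahnSeries.coeff_one, if_neg hj.ne]

theorem pow (hf : VanishesTo k f) (n : ℕ) : VanishesTo (n * k) (f ^ n) := by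
  induction n with
  | zero => simpa using one
  | succ n ih =>
    rw [pow_succ]
    exact (ih.mul hf).mono (by push_cast; linarith)

theorem order (f : LaurentSeries ℂ) : VanishesTo f.order f :=
  fun _ hj => HahnSeries.coeff_eq_zero_of_lt_order hj

theorem le_order (hf : VanishesTo k f) (h : f ≠ 0) : k ≤ f.order :=
  (HahnSeries.le_order_iff_forall h).2 hf

theorem inv (h : f ≠ 0) (hk : f.order ≤ k) : VanishesTo (-k) f⁻¹ := by
  have h1 := HahnSeries.order_mul h (inv_ne_zero h)
  rw [mul_inv_cancel₀ h, HahnSeries.order_one] at h1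
  exact (order _).mono (by omega)

theorem const (c : ℂ) : VanishesTo 0 (HahnSeries.C c) := by
  intro j hj
  rw [HahnSeries.C_apply, HahnSeries.coeff_single_of_ne hj.ne]

end VanishesTo

theorem eq_zero_of_vanishesTo {f : LaurentSeries ℂ} (h : ∀ k : ℤ, VanishesTo k f) : f = 0 := by
  ext j
  exact h (j + 1) j (by omega)

theorem xVar_pow (n : ℕ) : xVar ^ n = HahnSeries.single (-(n : ℤ)) 1 := by
  rw [xVar, HahnSeries.single_pow]
  simp

@[simp] theorem ofPoly_zero : ofPoly 0 = 0 := map_zero _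
@[simp] theorem ofPoly_one : ofPoly 1 = 1 := map_one _
theorem ofPoly_add (p q : ℂ[X]) : ofPoly (p + q) = ofPoly p + ofPoly q := map_add _ _ _
theorem ofPoly_sub (p q : ℂ[X]) : ofPoly (p - q) = ofPoly p - ofPoly q := map_sub _ _ _
theorem ofPoly_mul (p q : ℂ[X]) : ofPoly (p * q) = ofPoly p * ofPoly q := map_mul _ _ _
theorem ofPoly_neg (p : ℂ[X]) : ofPoly (-p) = -ofPoly p := map_neg _ _
theorem ofPoly_pow (p : ℂ[X]) (n : ℕ) : ofPoly (p ^ n) = ofPoly p ^ n := map_pow _ _ _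

theorem algebraMap_eq_C (c : ℂ) :
    algebraMap ℂ (LaurentSeries ℂ) c = HahnSeries.C c := by
  rw [HahnSeries.algebraMap_apply', ← PowerSeries.C_eq_algebraMap, HahnSeries.ofPowerSeries_C]

theorem ofPoly_C (c : ℂ) : ofPoly (C c) = HahnSeries.C c := by
  rw [ofPoly, aeval_C, algebraMap_eq_C]

theorem ofPoly_eq_sum (p : ℂ[X]) : ofPoly p =
    ∑ i ∈ Finset.range (p.natDegree + 1), HahnSeries.single (-(i : ℤ)) (p.coeff i) := by
  rw [ofPoly, aeval_eq_sum_range]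
  refine Finset.sum_congr rfl fun i _ => ?_
  rw [xVar_pow, Algebra.smul_def, algebraMap_eq_C, HahnSeries.C_apply, HahnSeries.single_mul_single,
    zero_add, mul_one]

theorem coeff_ofPoly_neg (p : ℂ[X]) (n : ℕ) : (ofPoly p).coeff (-(n : ℤ)) = p.coeff n := by
  rw [ofPoly_eq_sum, HahnSeries.coeff_sum]
  simp only [HahnSeries.coeff_single, neg_inj, Nat.cast_inj]
  rw [Finset.sum_ite_eq]
  split_ifs with h
  · rfl
  · rw [coeff_eq_zero_of_natDegree_lt]
    simpa [Nat.lt_succ_iff] using h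

theorem coeff_ofPoly_pos (p : ℂ[X]) {k : ℤ} (hk : 0 < k) : (ofPoly p).coeff k = 0 := by
  rw [ofPoly_eq_sum, HahnSeries.coeff_sum]
  refine Finset.sum_eq_zero fun i _ => ?_
  rw [HahnSeries.coeff_single_of_ne]
  omega

theorem vanishesTo_ofPoly {p : ℂ[X]} {n : ℕ} : VanishesTo (-n) (ofPoly p) ↔ p.natDegree ≤ n := by
  constructor
  · intro h
    refine natDegree_le_iff_coeff_eq_zero.2 fun i hi => ?_
    rw [← coeff_ofPoly_neg]
    exact h _ (by omega)
  · intro h j hj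
    obtain ⟨i, rfl⟩ : ∃ i : ℕ, j = -(i : ℤ) := ⟨(-j).toNat, by omega⟩
    rw [coeff_ofPoly_neg, coeff_eq_zero_of_natDegree_lt (by omega)]

theorem ofPoly_injective : Function.Injective ofPoly := by
  intro p q h
  ext n
  rw [← coeff_ofPoly_neg, h, coeff_ofPoly_neg]

theorem eq_zero_of_ofPoly_vanishesTo {p : ℂ[X]} (h : VanishesTo 1 (ofPoly p)) : p = 0 := by
  ext n
  rw [← coeff_ofPoly_neg, h _ (by omega), coeff_zero]

theorem ofPoly_ne_zero {p : ℂ[X]} (h : p ≠ 0) : ofPoly p ≠ 0 := by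
  rw [← ofPoly_zero]
  exact ofPoly_injective.ne h

theorem order_ofPoly {p : ℂ[X]} (h : p ≠ 0) : (ofPoly p).order = -p.natDegree := by
  refine le_antisymm (HahnSeries.order_le_of_coeff_ne_zero ?_)
    ((vanishesTo_ofPoly.2 le_rfl).le_order (ofPoly_ne_zero h))
  rw [coeff_ofPoly_neg]
  simpa using h

theorem coeff_ofPoly_mul (p : ℂ[X]) (f : LaurentSeries ℂ) (k : ℤ) : (ofPoly p * f).coeff k =
    ∑ i ∈ Finset.range (p.natDegree + 1), p.coeff i * f.coeff (k + i) := by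
  rw [ofPoly_eq_sum, Finset.sum_mul, HahnSeries.coeff_sum]
  refine Finset.sum_congr rfl fun i _ => ?_
  rw [HahnSeries.coeff_single_mul, sub_neg_eq_add]

/-! ### Substitution of a series of order -1. -/

theorem vanishesTo_heval {t : LaurentSeries ℂ} (ht : VanishesTo 1 t) (g : PowerSeries ℂ) :
    VanishesTo 0 (PowerSeries.heval t g) := by
  have ht' : 0 < t.orderTop :=
    lt_of_lt_of_le (b := ((1 : ℤ) : WithTop ℤ)) (by exact_mod_cast one_pos)
      (HahnSeries.le_orderTop_iff_forall.2 fun j hj => ht j (by exact_mod_cast hj))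
  intro j hj
  rw [PowerSeries.coeff_heval]
  refine (finsum_congr fun n => ?_).trans finsum_zero
  rw [HahnSeries.SummableFamily.coeff_apply,
    HahnSeries.SummableFamily.powerSeriesFamily_of_orderTop_pos ht', HahnSeries.coeff_smul,
    ht.pow n j (by omega), smul_zero]

/-- Substitution of a series of order `-1` is a ring endomorphism that respects the order. -/
theorem exists_substAtInfinity_ringHom {y : LaurentSeries ℂ} (hy0 : y ≠ 0) (hy : y.order = -1) :
    ∃ φ : LaurentSeries ℂ →+* LaurentSeries ℂ, (∀ f, substAtInfinity y f = φ f) ∧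
      (∀ p, φ (ofPoly p) = aeval y p) ∧ ∀ k f, VanishesTo k f → VanishesTo k (φ f) := by
  have ht : VanishesTo 1 y⁻¹ := by
    simpa using VanishesTo.inv (k := -1) hy0 hy.le
  have ht' : 0 < (y⁻¹).orderTop :=
    lt_of_lt_of_le (b := ((1 : ℤ) : WithTop ℤ)) (by exact_mod_cast one_pos)
      (HahnSeries.le_orderTop_iff_forall.2 fun j hj => ht j (by exact_mod_cast hj))
  let ψ : PowerSeries ℂ →+* LaurentSeries ℂ :=
    { toFun := fun g => PowerSeries.heval y⁻¹ g
      map_one' := map_one (PowerSeries.heval y⁻¹)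
      map_mul' := map_mul (PowerSeries.heval y⁻¹)
      map_zero' := map_zero (PowerSeries.heval y⁻¹)
      map_add' := map_add (PowerSeries.heval y⁻¹) }
  have hψC : ∀ c : ℂ, ψ (PowerSeries.C c) = HahnSeries.C c := by
    intro c
    refine (PowerSeries.heval_C y⁻¹ c).trans ?_
    ext j
    simp [HahnSeries.coeff_one, HahnSeries.coeff_single]
  have hX : ψ PowerSeries.X = y⁻¹ :=
    PowerSeries.heval_X _ ht'
  have hunit : ∀ z : Submonoid.powers (PowerSeries.X : PowerSeries ℂ),
      IsUnit (ψ z) := by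
    rintro ⟨_, n, rfl⟩
    simp only [map_pow, hX]
    exact (pow_ne_zero _ (inv_ne_zero hy0)).isUnit
  -- Laurent series are the localization of power series at powers of `X`, and `X` goes to the unit
  -- `y⁻¹`; multiplicativity then comes from the universal property.
  let φ : LaurentSeries ℂ →+* LaurentSeries ℂ := IsLocalization.lift hunit
  have hφ : ∀ g : PowerSeries ℂ,
      φ (HahnSeries.ofPowerSeries ℤ ℂ g) = ψ g := fun g =>
    IsLocalization.lift_eq hunit g
  have hφX : φ (HahnSeries.single 1 1) = y⁻¹ := by
    rw [← hX, ← hφ, HahnSeries.ofPowerSeries_X]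
  have hφzpow : ∀ n : ℤ, φ (HahnSeries.single n 1) = y⁻¹ ^ n := by
    intro n
    rw [← hφX, ← map_zpow₀, RatFunc.single_zpow]
  have hsubst : ∀ f, substAtInfinity y f = φ f := by
    intro f
    conv_rhs => rw [← LaurentSeries.single_order_mul_powerSeriesPart f]
    rw [map_mul, hφzpow, hφ]
    rfl
  refine ⟨φ, hsubst, ?_, ?_⟩
  · intro p
    have hC : ∀ c : ℂ, φ (algebraMap ℂ _ c) = algebraMap ℂ _ c := by
      intro c
      rw [algebraMap_eq_C, ← HahnSeries.ofPowerSeries_C, hφ, hψC,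
        HahnSeries.ofPowerSeries_C]
    have hx : φ xVar = y := by
      rw [xVar, hφzpow]
      simp
    rw [ofPoly, aeval_eq_sum_range, aeval_eq_sum_range, map_sum]
    refine Finset.sum_congr rfl fun i _ => ?_
    rw [Algebra.smul_def, Algebra.smul_def, map_mul, map_pow, hx, hC]
  · intro k f hf
    rcases eq_or_ne f 0 with rfl | hf0
    · rw [map_zero]
      exact fun _ _ => rfl
    rw [← hsubst, substAtInfinity]
    have h1 : ∀ n : ℤ, VanishesTo n (y⁻¹ ^ n) := by
      intro n
      rcases Int.le_total 0 n with h | h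
      · lift n to ℕ using h
        simpa using ht.pow n
      · obtain ⟨i, rfl⟩ : ∃ i : ℕ, n = -(i : ℤ) := ⟨(-n).toNat, by omega⟩
        have := (VanishesTo.order y).pow i
        rw [hy] at this
        simpa using this
    exact ((h1 f.order).mul (vanishesTo_heval ht f.powerSeriesPart)).mono
      (by have := hf.le_order hf0; omega)

/-! ### Orders of the lattice roots, and their difference. -/

namespace Lattice

variable (Λ : Lattice)

/-- As c ≠ 0, the orders of the roots add up to -2. If one were below -1, the other would be above
-1, and the sum of the roots could not be O(x). -/
theorem y_spec : (Λ.y₁ ≠ 0 ∧ Λ.y₁.order = -1) ∧ (Λ.y₂ ≠ 0 ∧ Λ.y₂.order = -1) := by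
  have hdeg : (C (1 / Λ.a) * (C Λ.c * X ^ 2 + C (2 * Λ.e) * X + C Λ.f)).natDegree = 2 := by
    rw [natDegree_C_mul (by simpa using Λ.a_ne_zero), natDegree_quadratic Λ.c_ne_zero]
  have hne : C (1 / Λ.a) * (C Λ.c * X ^ 2 + C (2 * Λ.e) * X + C Λ.f) ≠ 0 := by
    intro h
    rw [h] at hdeg
    simp at hdeg
  have hprod : Λ.y₁ * Λ.y₂ ≠ 0 := by
    rw [Λ.prod_eq]
    exact ofPoly_ne_zero hne
  have h1 := left_ne_zero_of_mul hprod
  have h2 := right_ne_zero_of_mul hprod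
  have horder : Λ.y₁.order + Λ.y₂.order = -2 := by
    rw [← HahnSeries.order_mul h1 h2, Λ.prod_eq, order_ofPoly hne, hdeg]
    rfl
  have hsum : VanishesTo (-1) (Λ.y₁ + Λ.y₂) := by
    rw [Λ.sum_eq]
    refine vanishesTo_ofPoly (n := 1).2 ?_
    exact (natDegree_C_mul_le _ _).trans natDegree_linear_le
  have key : ∀ y z : LaurentSeries ℂ, y ≠ 0 → y.order + z.order = -2 → VanishesTo (-1) (y + z) →
      -1 ≤ y.order := by
    intro y z hy ho hs
    by_contra! hlt
    have hz : VanishesTo (-1) z := (VanishesTo.order z).mono (by omega)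
    have := (hs.sub hz).le_order (by simpa using hy)
    rw [add_sub_cancel_right] at this
    omega
  have k1 := key _ _ h1 horder hsum
  have k2 := key _ Λ.y₁ h2 (by omega) (by rwa [add_comm])
  exact ⟨⟨h1, by omega⟩, h2, by omega⟩

/-- The square of Δ_y is a polynomial whose x² coefficient is 4λ/a². -/
theorem Δy_ne_zero : Λ.Δy ≠ 0 := by
  intro h
  have h1 : Λ.Δy ^ 2 = (Λ.y₁ + Λ.y₂) ^ 2 - 4 * (Λ.y₁ * Λ.y₂) := by
    rw [Δy]
    ring
  have h4 : (4 : LaurentSeries ℂ) = ofPoly (C 4) := by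
    exact (map_ofNat (aeval xVar : ℂ[X] →ₐ[ℂ] LaurentSeries ℂ) 4).symm
  rw [h, Λ.sum_eq, Λ.prod_eq, h4, ← ofPoly_pow, ← ofPoly_mul, ← ofPoly_sub, zero_pow two_ne_zero,
    ← ofPoly_zero] at h1
  have h2 := congrArg (fun p => coeff p 2) (ofPoly_injective h1)
  have h3 : (C (-2 / Λ.a) * (C Λ.b * X + C Λ.d)) ^ 2 -
      C 4 * (C (1 / Λ.a) * (C Λ.c * X ^ 2 + C (2 * Λ.e) * X + C Λ.f)) =
      C (4 / Λ.a ^ 2 * (Λ.b ^ 2 - Λ.a * Λ.c)) * X ^ 2 +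
      C (4 / Λ.a ^ 2 * (2 * Λ.b * Λ.d - 2 * Λ.a * Λ.e)) * X +
      C (4 / Λ.a ^ 2 * (Λ.d ^ 2 - Λ.a * Λ.f)) := by
    have ha := Λ.a_ne_zero
    have e1 : 4 / Λ.a ^ 2 * (Λ.b ^ 2 - Λ.a * Λ.c) =
      (-2 / Λ.a) ^ 2 * Λ.b ^ 2 - 4 * (1 / Λ.a) * Λ.c := by field
    have e2 : 4 / Λ.a ^ 2 * (2 * Λ.b * Λ.d - 2 * Λ.a * Λ.e) =
      2 * (-2 / Λ.a) ^ 2 * Λ.b * Λ.d - 4 * (1 / Λ.a) * (2 * Λ.e) := by field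
    have e3 : 4 / Λ.a ^ 2 * (Λ.d ^ 2 - Λ.a * Λ.f) =
      (-2 / Λ.a) ^ 2 * Λ.d ^ 2 - 4 * (1 / Λ.a) * Λ.f := by field
    rw [e1, e2, e3]
    simp only [C_sub, C_mul, C_pow]
    have : (C 2 : ℂ[X]) = 2 := rfl
    rw [this]
    ring
  rw [h3] at h2
  simp only [coeff_add, coeff_C_mul, coeff_X_pow, coeff_X, coeff_C, coeff_zero] at h2
  norm_num at h2
  exact (h2.resolve_left Λ.a_ne_zero) |> fun h => Λ.lambda_ne_zero h

end Lattice

/-! ### Padé approximants and functions of the second kind. -/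

theorem coeff_stieltjes (u : ℕ → ℂ) (n : ℕ) : (stieltjes u).coeff (n + 1) = u n := by
  have h := HahnSeries.ofPowerSeries_apply_coeff (Γ := ℤ) (PowerSeries.X * PowerSeries.mk u) (n + 1)
  rw [PowerSeries.coeff_succ_X_mul, PowerSeries.coeff_mk] at h
  exact_mod_cast h

theorem vanishesTo_stieltjes (u : ℕ → ℂ) : VanishesTo 1 (stieltjes u) := by
  rw [stieltjes, map_mul, HahnSeries.ofPowerSeries_X]
  have h1 : VanishesTo 1 (HahnSeries.single (1 : ℤ) (1 : ℂ)) := fun j hj =>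
    HahnSeries.coeff_single_of_ne hj.ne
  refine (h1.mul (m := 0) fun j hj => ?_).mono (by simp)
  rw [PowerSeries.coeff_coe, if_pos hj]

theorem exists_vanishesTo_neg (f : LaurentSeries ℂ) : ∃ m : ℕ, VanishesTo (-m) f :=
  ⟨(-f.order).toNat, (VanishesTo.order f).mono (by omega)⟩

theorem VanishesTo.ofPoly_C (c : ℂ) : VanishesTo 0 (ofPoly (C c)) := by
  rw [LaguerreHahn.ofPoly_C]
  exact VanishesTo.const c

namespace IsPadeSequence

variable {u : ℕ → ℂ} {P N : ℕ → ℂ[X]}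

theorem ofPoly_ne_zero (hP : IsPadeSequence u P N) (n : ℕ) : ofPoly (P n) ≠ 0 :=
  LaguerreHahn.ofPoly_ne_zero (hP n).1.ne_zero

theorem vanishesTo_denom (hP : IsPadeSequence u P N) (n : ℕ) : VanishesTo (-n) (ofPoly (P n)) :=
  vanishesTo_ofPoly.2 (hP n).2.1.le

theorem vanishesTo_inv_denom (hP : IsPadeSequence u P N) (n : ℕ) :
    VanishesTo n (ofPoly (P n))⁻¹ := by
  simpa using VanishesTo.inv (k := -n) (hP.ofPoly_ne_zero n)
    (by rw [order_ofPoly (hP n).1.ne_zero, (hP n).2.1])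

theorem vanishesTo_secondKind (hP : IsPadeSequence u P N) (n : ℕ) :
    VanishesTo (n + 1) (secondKind u P N (n + 1)) := by
  have h : VanishesTo (2 * n + 1) (stieltjes u - ofPoly (N n) / ofPoly (P n)) := (hP n).2.2
  have h' := (hP.vanishesTo_denom n).mul h
  rw [mul_sub, mul_div_cancel₀ _ (hP.ofPoly_ne_zero n)] at h'
  exact h'.mono (by omega)

/-- The Padé condition puts no explicit bound on the numerator; one follows from N_n = P_n S - q_n.
-/
theorem vanishesTo_numer (hP : IsPadeSequence u P N) (n : ℕ) : VanishesTo (-n) (ofPoly (N n)) := by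
  have h : ofPoly (N n) = ofPoly (P n) * stieltjes u - secondKind u P N (n + 1) := by
    rw [secondKind]
    ring
  rw [h]
  exact (((hP.vanishesTo_denom n).mul (vanishesTo_stieltjes u)).mono (by omega)).sub
    ((hP.vanishesTo_secondKind n).mono (by omega))

theorem denom_zero (hP : IsPadeSequence u P N) : P 0 = 1 :=
  (hP 0).1.natDegree_eq_zero.1 (hP 0).2.1

theorem numer_zero (hP : IsPadeSequence u P N) : N 0 = 0 := by
  refine eq_zero_of_ofPoly_vanishesTo ?_
  have h : ofPoly (N 0) = stieltjes u - secondKind u P N (0 + 1) := by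
    rw [secondKind, hP.denom_zero, ofPoly_one]
    ring
  rw [h]
  exact (vanishesTo_stieltjes u).sub ((hP.vanishesTo_secondKind 0).mono (by simp))

/-- The numerator only affects nonnegative powers of x, so the rows of the Hankel matrix applied to
the coefficients of P_n remain. -/
theorem coeff_secondKind (hP : IsPadeSequence u P N) (n k : ℕ) :
    (secondKind u P N (n + 1)).coeff (k + 1) =
      ∑ i : Fin (n + 1), u (k + i) * (P n).coeff i := by
  rw [secondKind, HahnSeries.coeff_sub, coeff_ofPoly_pos _ (by omega), sub_zero, coeff_ofPoly_mul,
    (hP n).2.1, Finset.sum_range]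
  refine Finset.sum_congr rfl fun i _ => ?_
  rw [← coeff_stieltjes u, mul_comm]
  congr 2
  push_cast
  ring

/-- Otherwise the coefficient vector of P_n, nonzero since P_n is monic, would lie in the kernel of
a regular Hankel matrix. -/
theorem coeff_secondKind_ne_zero (hP : IsPadeSequence u P N) (hu : RegularMoments u) (n : ℕ) :
    (secondKind u P N (n + 1)).coeff (n + 1) ≠ 0 := by
  intro h0
  refine hu.2 n (Matrix.exists_mulVec_eq_zero_iff.1
    ⟨fun i : Fin (n + 1) => (P n).coeff i, ?_, ?_⟩)
  · intro h
    have h1 := congrFun h (Fin.last n)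
    have h2 := (hP n).1.coeff_natDegree
    rw [(hP n).2.1] at h2
    simp [h2] at h1
  · ext k
    rw [Matrix.mulVec, dotProduct]
    simp only [Matrix.of_apply, Pi.zero_apply]
    rw [← hP.coeff_secondKind n k]
    rcases (Nat.lt_succ_iff.1 k.2).lt_or_eq with hk | hk
    · exact hP.vanishesTo_secondKind n _ (by omega)
    · rw [hk, h0]

/-- The Casorati determinant of consecutive Padé approximants is a nonzero constant. -/
theorem exists_casorati (hP : IsPadeSequence u P N) (hu : RegularMoments u) (n : ℕ) :
    ∃ δ : ℂ, δ ≠ 0 ∧ P (n + 1) * N n - N (n + 1) * P n = C δ := by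
  have hd : ofPoly (P (n + 1) * N n - N (n + 1) * P n) =
      secondKind u P N (n + 2) * ofPoly (P n) -
        ofPoly (P (n + 1)) * secondKind u P N (n + 1) := by
    rw [secondKind, secondKind, ofPoly_sub, ofPoly_mul, ofPoly_mul]
    ring
  have hv1 := (hP.vanishesTo_secondKind (n + 1)).mul (hP.vanishesTo_denom n)
  have hv2 := (hP.vanishesTo_denom (n + 1)).mul (hP.vanishesTo_secondKind n)
  -- Here q_{n+1} P_n = O(x^(-2)) and P_{n+1} q_n = O(1).
  have hdeg : (P (n + 1) * N n - N (n + 1) * P n).natDegree ≤ 0 := by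
    rw [← vanishesTo_ofPoly, hd]
    exact (hv1.mono (by push_cast; omega)).sub (hv2.mono (by push_cast; omega))
  have hC := eq_C_of_natDegree_le_zero hdeg
  refine ⟨_, fun h => ?_, hC⟩
  rw [h, C_0] at hC
  rw [hC, ofPoly_zero, eq_comm, sub_eq_zero] at hd
  -- If the constant were zero, q_n = q_{n+1} P_n / P_{n+1} would vanish to order n + 3, against its
  -- nonzero leading coefficient at n + 1.
  have hq : secondKind u P N (n + 1) =
      (ofPoly (P (n + 1)))⁻¹ * (secondKind u P N (n + 2) * ofPoly (P n)) := by
    rw [hd, inv_mul_cancel_left₀ (hP.ofPoly_ne_zero _)]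
  have hv := (hP.vanishesTo_inv_denom (n + 1)).mul hv1
  rw [← hq] at hv
  exact hP.coeff_secondKind_ne_zero hu n (hv _ (by push_cast; omega))

end IsPadeSequence

/-! ### The operators 𝔼₁ and 𝔼₂ as ring endomorphisms. -/

namespace Lattice

variable (Λ : Lattice)

theorem exists_E₁ : ∃ φ : LaurentSeries ℂ →+* LaurentSeries ℂ, (∀ f, Λ.E₁ f = φ f) ∧
    (∀ p, φ (ofPoly p) = aeval Λ.y₁ p) ∧ ∀ k f, VanishesTo k f → VanishesTo k (φ f) :=
  exists_substAtInfinity_ringHom Λ.y_spec.1.1 Λ.y_spec.1.2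

theorem exists_E₂ : ∃ φ : LaurentSeries ℂ →+* LaurentSeries ℂ, (∀ f, Λ.E₂ f = φ f) ∧
    (∀ p, φ (ofPoly p) = aeval Λ.y₂ p) ∧ ∀ k f, VanishesTo k f → VanishesTo k (φ f) :=
  exists_substAtInfinity_ringHom Λ.y_spec.2.1 Λ.y_spec.2.2

/-- The ring endomorphism `𝔼₁`. -/
def E₁Hom : LaurentSeries ℂ →+* LaurentSeries ℂ := Λ.exists_E₁.choose

/-- The ring endomorphism `𝔼₂`. -/
def E₂Hom : LaurentSeries ℂ →+* LaurentSeries ℂ := Λ.exists_E₂.choose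

theorem E₁_eq (f : LaurentSeries ℂ) : Λ.E₁ f = Λ.E₁Hom f := Λ.exists_E₁.choose_spec.1 f
theorem E₂_eq (f : LaurentSeries ℂ) : Λ.E₂ f = Λ.E₂Hom f := Λ.exists_E₂.choose_spec.1 f

theorem E₁_ofPoly (p : ℂ[X]) : Λ.E₁ (ofPoly p) = aeval Λ.y₁ p :=
  (Λ.E₁_eq _).trans (Λ.exists_E₁.choose_spec.2.1 p)

theorem E₂_ofPoly (p : ℂ[X]) : Λ.E₂ (ofPoly p) = aeval Λ.y₂ p :=
  (Λ.E₂_eq _).trans (Λ.exists_E₂.choose_spec.2.1 p)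

theorem E₁_mul (f g : LaurentSeries ℂ) : Λ.E₁ (f * g) = Λ.E₁ f * Λ.E₁ g := by
  simp only [E₁_eq, map_mul]

theorem E₂_mul (f g : LaurentSeries ℂ) : Λ.E₂ (f * g) = Λ.E₂ f * Λ.E₂ g := by
  simp only [E₂_eq, map_mul]

theorem E₁_sub (f g : LaurentSeries ℂ) : Λ.E₁ (f - g) = Λ.E₁ f - Λ.E₁ g := by
  simp only [E₁_eq, map_sub]

theorem E₂_sub (f g : LaurentSeries ℂ) : Λ.E₂ (f - g) = Λ.E₂ f - Λ.E₂ g := by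
  simp only [E₂_eq, map_sub]

theorem E₁_one : Λ.E₁ 1 = 1 := by rw [E₁_eq, map_one]

theorem E₁_inv (f : LaurentSeries ℂ) : Λ.E₁ f⁻¹ = (Λ.E₁ f)⁻¹ := by
  simp only [E₁_eq, map_inv₀]

theorem E₂_inv (f : LaurentSeries ℂ) : Λ.E₂ f⁻¹ = (Λ.E₂ f)⁻¹ := by
  simp only [E₂_eq, map_inv₀]

theorem E₁_ne_zero {f : LaurentSeries ℂ} (hf : f ≠ 0) : Λ.E₁ f ≠ 0 := by
  rw [E₁_eq]
  exact (_root_.map_ne_zero _).2 hf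

theorem E₂_ne_zero {f : LaurentSeries ℂ} (hf : f ≠ 0) : Λ.E₂ f ≠ 0 := by
  rw [E₂_eq]
  exact (_root_.map_ne_zero _).2 hf

end Lattice

theorem VanishesTo.E₁ {k : ℤ} {f : LaurentSeries ℂ} (hf : VanishesTo k f) (Λ : Lattice) :
    VanishesTo k (Λ.E₁ f) := by
  rw [Λ.E₁_eq]
  exact Λ.exists_E₁.choose_spec.2.2 k f hf

theorem VanishesTo.E₂ {k : ℤ} {f : LaurentSeries ℂ} (hf : VanishesTo k f) (Λ : Lattice) :
    VanishesTo k (Λ.E₂ f) := by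
  rw [Λ.E₂_eq]
  exact Λ.exists_E₂.choose_spec.2.2 k f hf

theorem two_ne_zero_laurent : (2 : LaurentSeries ℂ) ≠ 0 := by
  have h : (2 : LaurentSeries ℂ) = ofPoly 2 :=
    (map_ofNat (aeval xVar : ℂ[X] →ₐ[ℂ] LaurentSeries ℂ) 2).symm
  rw [h]
  exact ofPoly_ne_zero two_ne_zero

theorem ofPoly_C_half_mul_two : ofPoly (C (1 / 2)) * 2 = 1 := by
  have h : (2 : LaurentSeries ℂ) = ofPoly (C 2) :=
    (map_ofNat (aeval xVar : ℂ[X] →ₐ[ℂ] LaurentSeries ℂ) 2).symm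
  rw [h, ← ofPoly_mul, ← C_mul]
  norm_num

theorem ofPoly_C_half : ofPoly (C (1 / 2)) = 1 / 2 :=
  eq_div_of_mul_eq two_ne_zero_laurent ofPoly_C_half_mul_two

/-! ### Conjugation y₁ ↔ y₂ on ℂ[x] + Δ_y ℂ[x]. -/

namespace Lattice

variable (Λ : Lattice)

/-- `u = g - Δ_y h` and `v = g + Δ_y h` for polynomials `g` and `h`. -/
def IsConjPair (u v : LaurentSeries ℂ) : Prop :=
  ∃ g h : ℂ[X], u = ofPoly g - Λ.Δy * ofPoly h ∧ v = ofPoly g + Λ.Δy * ofPoly h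

theorem exists_Δy_sq : ∃ w : ℂ[X], Λ.Δy ^ 2 = ofPoly w := by
  have h1 : Λ.Δy ^ 2 = (Λ.y₁ + Λ.y₂) ^ 2 - 4 * (Λ.y₁ * Λ.y₂) := by
    rw [Δy]
    ring
  have h4 : (4 : LaurentSeries ℂ) = ofPoly (C 4) :=
    (map_ofNat (aeval xVar : ℂ[X] →ₐ[ℂ] LaurentSeries ℂ) 4).symm
  rw [h1, Λ.sum_eq, Λ.prod_eq, h4, ← ofPoly_pow, ← ofPoly_mul, ← ofPoly_sub]
  exact ⟨_, rfl⟩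

namespace IsConjPair

variable {Λ} {u v u' v' : LaurentSeries ℂ}

theorem of_poly (p : ℂ[X]) : Λ.IsConjPair (ofPoly p) (ofPoly p) :=
  ⟨p, 0, by simp, by simp⟩

theorem symm (h : Λ.IsConjPair u v) : Λ.IsConjPair v u := by
  obtain ⟨g, h, rfl, rfl⟩ := h
  exact ⟨g, -h, by rw [ofPoly_neg]; ring, by rw [ofPoly_neg]; ring⟩

theorem add (h : Λ.IsConjPair u v) (h' : Λ.IsConjPair u' v') :
    Λ.IsConjPair (u + u') (v + v') := by
  obtain ⟨g, h, rfl, rfl⟩ := h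
  obtain ⟨g', h', rfl, rfl⟩ := h'
  exact ⟨g + g', h + h', by rw [ofPoly_add, ofPoly_add]; ring,
    by rw [ofPoly_add, ofPoly_add]; ring⟩

theorem sub (h : Λ.IsConjPair u v) (h' : Λ.IsConjPair u' v') :
    Λ.IsConjPair (u - u') (v - v') := by
  obtain ⟨g, h, rfl, rfl⟩ := h
  obtain ⟨g', h', rfl, rfl⟩ := h'
  exact ⟨g - g', h - h', by rw [ofPoly_sub, ofPoly_sub]; ring,
    by rw [ofPoly_sub, ofPoly_sub]; ring⟩

theorem mul (h : Λ.IsConjPair u v) (h' : Λ.IsConjPair u' v') :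
    Λ.IsConjPair (u * u') (v * v') := by
  obtain ⟨g, h, rfl, rfl⟩ := h
  obtain ⟨g', h', rfl, rfl⟩ := h'
  obtain ⟨w, hw⟩ := Λ.exists_Δy_sq
  refine ⟨g * g' + w * (h * h'), g * h' + h * g', ?_, ?_⟩ <;>
  · simp only [ofPoly_add, ofPoly_mul, ← hw]
    ring

theorem pow (h : Λ.IsConjPair u v) (n : ℕ) : Λ.IsConjPair (u ^ n) (v ^ n) := by
  induction n with
  | zero => simpa using of_poly (Λ := Λ) 1
  | succ n ih =>
    rw [pow_succ, pow_succ]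
    exact ih.mul h

/-- Divided differences of conjugates are polynomials. -/
theorem exists_div (h : Λ.IsConjPair u v) : ∃ p : ℂ[X], (v - u) / Λ.Δy = ofPoly p := by
  obtain ⟨g, h, rfl, rfl⟩ := h
  refine ⟨h + h, ?_⟩
  rw [div_eq_iff Λ.Δy_ne_zero, ofPoly_add]
  ring

theorem exists_ofPoly (h : Λ.IsConjPair u u) : ∃ p : ℂ[X], u = ofPoly p := by
  obtain ⟨g, h, h1, h2⟩ := h
  refine ⟨g, ?_⟩
  have h3 : 2 * (Λ.Δy * ofPoly h) = 0 := by linear_combination h1 - h2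
  rw [h1, (mul_eq_zero.1 h3).resolve_left two_ne_zero_laurent, sub_zero]

end IsConjPair

theorem isConjPair_y : Λ.IsConjPair Λ.y₁ Λ.y₂ := by
  refine ⟨C (1 / 2) * (C (-2 / Λ.a) * (C Λ.b * X + C Λ.d)), C (1 / 2), ?_, ?_⟩
  · rw [ofPoly_mul, ← Λ.sum_eq, Δy]
    linear_combination -Λ.y₁ * ofPoly_C_half_mul_two
  · rw [ofPoly_mul, ← Λ.sum_eq, Δy]
    linear_combination -Λ.y₂ * ofPoly_C_half_mul_two

theorem isConjPair_E (p : ℂ[X]) : Λ.IsConjPair (Λ.E₁ (ofPoly p)) (Λ.E₂ (ofPoly p)) := by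
  rw [E₁_ofPoly, E₂_ofPoly]
  induction p using Polynomial.induction_on' with
  | add p q hp hq =>
    rw [map_add, map_add]
    exact hp.add hq
  | monomial n a =>
    rw [aeval_monomial, aeval_monomial, algebraMap_eq_C, ← ofPoly_C]
    exact (IsConjPair.of_poly _).mul (Λ.isConjPair_y.pow n)

theorem E₁_ofPoly_C (c : ℂ) : Λ.E₁ (ofPoly (C c)) = ofPoly (C c) := by
  rw [E₁_ofPoly, aeval_C, algebraMap_eq_C, ofPoly_C]

theorem E₂_ofPoly_C (c : ℂ) : Λ.E₂ (ofPoly (C c)) = ofPoly (C c) := by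
  rw [E₂_ofPoly, aeval_C, algebraMap_eq_C, ofPoly_C]

end Lattice

/-! ### The cleared Riccati defect. -/

/-- The defect of a fraction `f / g` in the Riccati equation, with denominators cleared. -/
def clearedDefect (Λ : Lattice) (A B C D f g : LaurentSeries ℂ) : LaurentSeries ℂ :=
  A * ((Λ.E₁ g * Λ.E₂ f - Λ.E₁ f * Λ.E₂ g) / Λ.Δy) - B * (Λ.E₁ f * Λ.E₂ f)
    - C / 2 * (Λ.E₁ f * Λ.E₂ g + Λ.E₁ g * Λ.E₂ f) - D * (Λ.E₁ g * Λ.E₂ g)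

/-- The increment of the cleared defect when the numerator `f` is changed to `f + q`. -/
def defectIncrement (Λ : Lattice) (A B C f g q : LaurentSeries ℂ) : LaurentSeries ℂ :=
  A * Λ.Δy⁻¹ * (Λ.E₁ g * Λ.E₂ q - Λ.E₁ q * Λ.E₂ g)
    - B * (Λ.E₁ f * Λ.E₂ q + Λ.E₁ q * Λ.E₂ f + Λ.E₁ q * Λ.E₂ q)
    - C / 2 * (Λ.E₁ q * Λ.E₂ g + Λ.E₁ g * Λ.E₂ q)

variable {Λ : Lattice} {A B C D : ℂ[X]} {u : ℕ → ℂ} {P N : ℕ → ℂ[X]}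

/-- Since f + q = g S, passing from f to f + q turns the fraction f / g into `S`. -/
theorem riccati_defect_eq (S f g q : LaurentSeries ℂ) (A B C D : LaurentSeries ℂ)
    (hq : q = g * S - f) :
    Λ.E₁ g * Λ.E₂ g * (A * Λ.D S - (B * Λ.E₁ S * Λ.E₂ S + C * Λ.M S + D)) =
      clearedDefect Λ A B C D f g + defectIncrement Λ A B C f g q := by
  rw [hq, clearedDefect, defectIncrement, Lattice.D, Lattice.M]
  simp only [Λ.E₁_sub, Λ.E₂_sub, Λ.E₁_mul, Λ.E₂_mul]
  have h2 := two_ne_zero_laurent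
  field_simp
  ring

/-- Each of the four terms is invariant under conjugation: the divided difference because numerator
and Δ_y both change sign, the others by symmetry. -/
theorem exists_clearedDefect_eq_ofPoly (Λ : Lattice) (A B C D p q : ℂ[X]) :
    ∃ w, clearedDefect Λ (ofPoly A) (ofPoly B) (ofPoly C) (ofPoly D) (ofPoly p) (ofPoly q) =
      ofPoly w := by
  have hp := Λ.isConjPair_E p
  have hq := Λ.isConjPair_E q
  obtain ⟨w₁, h₁⟩ := (hp.mul hq.symm).exists_div
  obtain ⟨w₂, h₂⟩ : ∃ w, Λ.E₁ (ofPoly p) * Λ.E₂ (ofPoly p) = ofPoly w := by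
    have h := hp.mul hp.symm
    rw [mul_comm (Λ.E₂ _)] at h
    exact h.exists_ofPoly
  obtain ⟨w₃, h₃⟩ : ∃ w, Λ.E₁ (ofPoly p) * Λ.E₂ (ofPoly q) + Λ.E₁ (ofPoly q) * Λ.E₂ (ofPoly p) =
      ofPoly w := by
    have h := (hp.mul hq.symm).add (hq.mul hp.symm)
    have e : Λ.E₂ (ofPoly p) * Λ.E₁ (ofPoly q) + Λ.E₂ (ofPoly q) * Λ.E₁ (ofPoly p) =
      Λ.E₁ (ofPoly p) * Λ.E₂ (ofPoly q) + Λ.E₁ (ofPoly q) * Λ.E₂ (ofPoly p) := by ring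
    rw [e] at h
    exact h.exists_ofPoly
  obtain ⟨w₄, h₄⟩ : ∃ w, Λ.E₁ (ofPoly q) * Λ.E₂ (ofPoly q) = ofPoly w := by
    have h := hq.mul hq.symm
    rw [mul_comm (Λ.E₂ _)] at h
    exact h.exists_ofPoly
  refine ⟨A * w₁ - B * w₂ - Polynomial.C (1 / 2) * C * w₃ - D * w₄, ?_⟩
  rw [clearedDefect, h₃, h₂, h₄, mul_comm (Λ.E₁ (ofPoly q)), h₁]
  simp only [ofPoly_sub, ofPoly_mul, ofPoly_C_half]
  ring

/-- The increment of the cleared defect of the Padé approximants is bounded in degree. -/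
theorem exists_vanishesTo_defectIncrement (Λ : Lattice) (A B C : LaurentSeries ℂ)
    (hP : IsPadeSequence u P N) : ∃ m : ℕ, ∀ n, VanishesTo (-m)
      (defectIncrement Λ A B C (ofPoly (N n)) (ofPoly (P n)) (secondKind u P N (n + 1))) := by
  obtain ⟨m₁, h₁⟩ := exists_vanishesTo_neg (A * Λ.Δy⁻¹)
  obtain ⟨m₂, h₂⟩ := exists_vanishesTo_neg B
  obtain ⟨m₃, h₃⟩ := exists_vanishesTo_neg (C / 2)
  refine ⟨m₁ + m₂ + m₃, fun n => ?_⟩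
  have hp := hP.vanishesTo_denom n
  have hn := hP.vanishesTo_numer n
  have hq := hP.vanishesTo_secondKind n
  have aux : ∀ {f g : LaurentSeries ℂ}, VanishesTo (-n) f → VanishesTo (n + 1) g →
      VanishesTo 0 (Λ.E₁ f * Λ.E₂ g) ∧ VanishesTo 0 (Λ.E₁ g * Λ.E₂ f) := fun hf hg =>
    ⟨((hf.E₁ Λ).mul (hg.E₂ Λ)).mono (by omega), ((hg.E₁ Λ).mul (hf.E₂ Λ)).mono (by omega)⟩
  have hqq := ((hq.E₁ Λ).mul (hq.E₂ Λ)).mono (m := 0) (by omega)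
  rw [defectIncrement]
  exact (((h₁.mul ((aux hp hq).1.sub (aux hp hq).2)).mono (by push_cast; omega)).sub
    ((h₂.mul (((aux hn hq).1.add (aux hn hq).2).add hqq)).mono (by push_cast; omega))).sub
    ((h₃.mul ((aux hp hq).2.add (aux hp hq).1)).mono (by push_cast; omega))

theorem riccati_iff_sub_eq_zero (S : LaurentSeries ℂ) : Riccati Λ A B C D S ↔
    ofPoly A * Λ.D S - (ofPoly B * Λ.E₁ S * Λ.E₂ S + ofPoly C * Λ.M S + ofPoly D) = 0 :=
  sub_eq_zero.symm

/-! ### The implications between the three statements. -/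

theorem E₁_casorati {n : ℕ} {δ : ℂ} (h : P (n + 1) * N n - N (n + 1) * P n = Polynomial.C δ) :
    Λ.E₁ (ofPoly (P (n + 1))) * Λ.E₁ (ofPoly (N n)) -
      Λ.E₁ (ofPoly (N (n + 1))) * Λ.E₁ (ofPoly (P n)) = ofPoly (Polynomial.C δ) := by
  rw [← Λ.E₁_ofPoly_C, ← h, ofPoly_sub, ofPoly_mul, ofPoly_mul, Λ.E₁_sub, Λ.E₁_mul, Λ.E₁_mul]

theorem E₂_casorati {n : ℕ} {δ : ℂ} (h : P (n + 1) * N n - N (n + 1) * P n = Polynomial.C δ) :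
    Λ.E₂ (ofPoly (P (n + 1))) * Λ.E₂ (ofPoly (N n)) -
      Λ.E₂ (ofPoly (N (n + 1))) * Λ.E₂ (ofPoly (P n)) = ofPoly (Polynomial.C δ) := by
  rw [← Λ.E₂_ofPoly_C, ← h, ofPoly_sub, ofPoly_mul, ofPoly_mul, Λ.E₂_sub, Λ.E₂_mul, Λ.E₂_mul]

theorem riccati_of_structureRelations (hu : RegularMoments u) (hP : IsPadeSequence u P N)
    {l π Θ : ℕ → ℂ[X]} (hdeg : UniformlyBoundedDegrees l π Θ)
    (h : StructureRelations Λ A B C D P N l π Θ) : Riccati Λ A B C D (stieltjes u) := by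
  rw [riccati_iff_sub_eq_zero]
  obtain ⟨m, hm⟩ := exists_vanishesTo_defectIncrement Λ (ofPoly A) (ofPoly B) (ofPoly C) hP
  obtain ⟨m', hm'⟩ := hdeg
  have hdefect : ∀ n : ℕ, VanishesTo (-(m' : ℤ)) (clearedDefect Λ (ofPoly A) (ofPoly B) (ofPoly C)
      (ofPoly D) (ofPoly (N (n + 1))) (ofPoly (P (n + 1)))) := by
    intro n
    obtain ⟨δ, -, hδ⟩ := hP.exists_casorati hu n
    obtain ⟨h1, h2⟩ := h (n + 1) (by omega)
    rw [add_tsub_cancel_right] at h1 h2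
    have e : clearedDefect Λ (ofPoly A) (ofPoly B) (ofPoly C) (ofPoly D) (ofPoly (N (n + 1)))
        (ofPoly (P (n + 1))) = ofPoly (Θ (n + 1)) * ofPoly (Polynomial.C δ) := by
      rw [← E₁_casorati (Λ := Λ) hδ, clearedDefect]
      rw [Lattice.D] at h1 h2
      -- This combination cancels l + Δ_y π and makes the Casorati determinant the factor of Θ.
      linear_combination Λ.E₁ (ofPoly (P (n + 1))) * h2 - Λ.E₁ (ofPoly (N (n + 1))) * h1
    rw [e]
    exact ((vanishesTo_ofPoly.2 (hm' (n + 1)).2.2).mul (VanishesTo.ofPoly_C δ)).mono (by omega)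
  refine eq_zero_of_vanishesTo fun k => ?_
  -- Dividing by E₁P_{n+1} E₂P_{n+1} gains 2(n + 1) orders against the fixed loss m + m'.
  obtain ⟨n, hn⟩ : ∃ n : ℕ, k + m + m' ≤ n := ⟨(k + m + m').toNat, by omega⟩
  have hR := riccati_defect_eq (Λ := Λ) (stieltjes u) (ofPoly (N (n + 1))) (ofPoly (P (n + 1)))
    (secondKind u P N (n + 2)) (ofPoly A) (ofPoly B) (ofPoly C) (ofPoly D) rfl
  have hv := (((hdefect n).mono (m := -(m + m')) (by omega)).add
    ((hm (n + 1)).mono (m := -(m + m')) (by omega)))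
  rw [← hR] at hv
  have hinv := hP.vanishesTo_inv_denom (n + 1)
  have h1 := hinv.E₁ Λ
  have h2 := hinv.E₂ Λ
  rw [Λ.E₁_inv] at h1
  rw [Λ.E₂_inv] at h2
  have hne1 := Λ.E₁_ne_zero (hP.ofPoly_ne_zero (n + 1))
  have hne2 := Λ.E₂_ne_zero (hP.ofPoly_ne_zero (n + 1))
  have hv' := ((h1.mul h2).mul hv).mono (m := k) (by push_cast; omega)
  rwa [← mul_inv, inv_mul_cancel_left₀ (mul_ne_zero hne1 hne2)] at hv'

theorem secondKindRelation_of_riccati (hP : IsPadeSequence u P N) {l π Θ : ℕ → ℂ[X]}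
    (hinit : InitialConditions C D l π Θ) (h : StructureRelations Λ A B C D P N l π Θ)
    (hR : Riccati Λ A B C D (stieltjes u)) :
    SecondKindRelation Λ A B C (stieltjes u) (secondKind u P N) l π Θ := by
  rw [Riccati, Lattice.D, Lattice.M] at hR
  rintro (_ | n)
  · obtain ⟨hl, hπ, hΘ⟩ := hinit
    have hS : secondKind u P N (0 + 1) = stieltjes u := by
      rw [secondKind, hP.denom_zero, hP.numer_zero, ofPoly_one, ofPoly_zero]
      ring
    rw [hS, hl, hπ, hΘ, secondKind, Λ.E₁_one, ofPoly_mul, ofPoly_C_half, ofPoly_zero, Lattice.D]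
    linear_combination hR
  · obtain ⟨h1, h2⟩ := h (n + 1) (by omega)
    rw [add_tsub_cancel_right] at h1 h2
    simp only [secondKind, Lattice.D, Λ.E₁_sub, Λ.E₂_sub, Λ.E₁_mul, Λ.E₂_mul] at h1 h2 ⊢
    linear_combination Λ.E₁ (stieltjes u) * h1 - h2 + Λ.E₂ (ofPoly (P (n + 1))) * hR

/-- With q_{-1} = 1, q_0 = S and the initial conditions, the relation at n = 0 is already the
Riccati equation. -/
theorem riccati_of_secondKindRelation (hP : IsPadeSequence u P N) {l π Θ : ℕ → ℂ[X]}
    (hinit : InitialConditions C D l π Θ)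
    (h : SecondKindRelation Λ A B C (stieltjes u) (secondKind u P N) l π Θ) :
    Riccati Λ A B C D (stieltjes u) := by
  obtain ⟨hl, hπ, hΘ⟩ := hinit
  have hS : secondKind u P N (0 + 1) = stieltjes u := by
    rw [secondKind, hP.denom_zero, hP.numer_zero, ofPoly_one, ofPoly_zero]
    ring
  have h0 := h 0
  rw [hS, hl, hπ, hΘ, secondKind, Λ.E₁_one, ofPoly_mul, ofPoly_C_half, ofPoly_zero] at h0
  rw [Riccati, h0, Lattice.M]
  ring

/-- The Riccati equation yields the structure relations, with coefficients of bounded degrees. -/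
theorem exists_structureRelations_of_riccati (hu : RegularMoments u) (hP : IsPadeSequence u P N)
    (hR : Riccati Λ A B C D (stieltjes u)) :
    ∃ m : ℕ, ∀ n : ℕ, ∃ l π Θ : ℂ[X], (l.natDegree ≤ m ∧ π.natDegree ≤ m ∧ Θ.natDegree ≤ m) ∧
      ofPoly A * Λ.D (ofPoly (P (n + 1))) =
        (ofPoly l + Λ.Δy * ofPoly π) * Λ.E₁ (ofPoly (P (n + 1)))
          - ofPoly C / 2 * Λ.E₂ (ofPoly (P (n + 1))) - ofPoly B * Λ.E₂ (ofPoly (N (n + 1)))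
          + ofPoly Θ * Λ.E₁ (ofPoly (P n)) ∧
      ofPoly A * Λ.D (ofPoly (N (n + 1))) =
        (ofPoly l + Λ.Δy * ofPoly π) * Λ.E₁ (ofPoly (N (n + 1)))
          + ofPoly C / 2 * Λ.E₂ (ofPoly (N (n + 1))) + ofPoly D * Λ.E₂ (ofPoly (P (n + 1)))
          + ofPoly Θ * Λ.E₁ (ofPoly (N n)) := by
  rw [riccati_iff_sub_eq_zero] at hR
  obtain ⟨m₀, hm₀⟩ := exists_vanishesTo_defectIncrement Λ (ofPoly A) (ofPoly B) (ofPoly C) hP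
  obtain ⟨m₁, hm₁⟩ := exists_vanishesTo_neg (ofPoly A * Λ.Δy⁻¹)
  obtain ⟨m₂, hm₂⟩ := exists_vanishesTo_neg (ofPoly B)
  obtain ⟨m₃, hm₃⟩ := exists_vanishesTo_neg (ofPoly C / 2)
  obtain ⟨m₄, hm₄⟩ := exists_vanishesTo_neg Λ.Δy⁻¹
  set m := m₀ + m₁ + m₂ + m₃ + m₄ with hm
  refine ⟨m + m, fun n => ?_⟩
  obtain ⟨δ, hδ0, hδ⟩ := hP.exists_casorati hu n
  have hc : ofPoly (Polynomial.C δ⁻¹) * ofPoly (Polynomial.C δ) = 1 := by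
    rw [← ofPoly_mul, ← Polynomial.C_mul, inv_mul_cancel₀ hδ0, C_1, ofPoly_one]
  have hcas1 := E₁_casorati (Λ := Λ) hδ
  have hcas2 := E₂_casorati (Λ := Λ) hδ
  obtain ⟨w, hw⟩ := exists_clearedDefect_eq_ofPoly Λ A B C D (N (n + 1)) (P (n + 1))
  have hdefect := riccati_defect_eq (Λ := Λ) (stieltjes u) (ofPoly (N (n + 1)))
    (ofPoly (P (n + 1))) (secondKind u P N (n + 2)) (ofPoly A) (ofPoly B) (ofPoly C) (ofPoly D) rfl
  rw [hR, mul_zero] at hdefect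
  have hwv : VanishesTo (-m) (ofPoly w) := by
    rw [← hw, eq_neg_of_add_eq_zero_left hdefect.symm]
    exact (hm₀ (n + 1)).neg.mono (by omega)
  rw [clearedDefect] at hw
  have hΘv : VanishesTo (-m) (ofPoly (Polynomial.C δ⁻¹ * w)) := by
    rw [ofPoly_mul]
    exact ((VanishesTo.ofPoly_C _).mul hwv).mono (by omega)
  have hp := Λ.isConjPair_E (P (n + 1))
  have hn := Λ.isConjPair_E (N (n + 1))
  have hp' := Λ.isConjPair_E (P n)
  have hn' := Λ.isConjPair_E (N n)
  have hpv := hP.vanishesTo_denom (n + 1)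
  have hnv := hP.vanishesTo_numer (n + 1)
  have hpv' := hP.vanishesTo_denom n
  have hpi := hP.vanishesTo_inv_denom (n + 1)
  have hpi1 := hpi.E₁ Λ
  have hpi2 := hpi.E₂ Λ
  rw [Λ.E₁_inv] at hpi1
  rw [Λ.E₂_inv] at hpi2
  have hne1 := Λ.E₁_ne_zero (hP.ofPoly_ne_zero (n + 1))
  have hne2 := Λ.E₂_ne_zero (hP.ofPoly_ne_zero (n + 1))
  obtain ⟨dp, hdp⟩ := hp.exists_div
  obtain ⟨dn, hdn⟩ := hn.exists_div
  have hp1v := hpv.E₁ Λ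
  have hp2v := hpv.E₂ Λ
  have hn1v := hnv.E₁ Λ
  have hn2v := hnv.E₂ Λ
  have hp1v' := hpv'.E₁ Λ
  have hp2v' := hpv'.E₂ Λ
  have hchalf : ofPoly (Polynomial.C (1 / 2) * C) = ofPoly C / 2 := by
    rw [ofPoly_mul, ofPoly_C_half]
    ring
  have hdpv : VanishesTo (-m - (n + 1)) (ofPoly A * ofPoly dp) := by
    rw [← hdp, div_eq_mul_inv, mul_comm (_ - _), ← mul_assoc]
    exact (hm₁.mul (hp2v.sub hp1v)).mono (by push_cast; omega)
  simp only [Lattice.D, hdp, hdn]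
  generalize Λ.E₁ (ofPoly (P (n + 1))) = p₁ at *
  generalize Λ.E₂ (ofPoly (P (n + 1))) = p₂ at *
  generalize Λ.E₁ (ofPoly (N (n + 1))) = n₁ at *
  generalize Λ.E₂ (ofPoly (N (n + 1))) = n₂ at *
  generalize Λ.E₁ (ofPoly (P n)) = p₁' at *
  generalize Λ.E₂ (ofPoly (P n)) = p₂' at *
  generalize Λ.E₁ (ofPoly (N n)) = n₁' at *
  generalize Λ.E₂ (ofPoly (N n)) = n₂' at *
  -- With L = l + Δ_y π, the relations read a₁ = L p₁ + Θ p₁' and b₁ = L n₁ + Θ n₁'; a₂ and b₂ are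
  -- the conjugates of a₁ and b₁.
  let a₁ := ofPoly A * ofPoly dp + ofPoly C / 2 * p₂ + ofPoly B * n₂
  let b₁ := ofPoly A * ofPoly dn - ofPoly C / 2 * n₂ - ofPoly D * p₂
  let a₂ := ofPoly A * ofPoly dp + ofPoly C / 2 * p₁ + ofPoly B * n₁
  let b₂ := ofPoly A * ofPoly dn - ofPoly C / 2 * n₁ - ofPoly D * p₁
  have hw1 : p₁ * b₁ - n₁ * a₁ = ofPoly w := by
    rw [← hw]
    simp only [a₁, b₁, ← hdp, ← hdn]
    ring
  have hw2 : p₂ * b₂ - n₂ * a₂ = ofPoly w := by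
    rw [← hw]
    simp only [a₂, b₂, ← hdp, ← hdn]
    ring
  have ha : Λ.IsConjPair a₁ a₂ := by
    simp only [a₁, a₂, ← hchalf]
    exact (((Lattice.IsConjPair.of_poly _).mul (.of_poly _)).add
      ((Lattice.IsConjPair.of_poly _).mul hp.symm)).add
      ((Lattice.IsConjPair.of_poly _).mul hn.symm)
  have hb : Λ.IsConjPair b₁ b₂ := by
    simp only [b₁, b₂, ← hchalf]
    exact (((Lattice.IsConjPair.of_poly _).mul (.of_poly _)).sub
      ((Lattice.IsConjPair.of_poly _).mul hn.symm)).sub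
      ((Lattice.IsConjPair.of_poly _).mul hp.symm)
  have hav1 : VanishesTo (-m - (n + 1)) a₁ :=
    (hdpv.add ((hm₃.mul hp2v).mono (by push_cast; omega))).add
      ((hm₂.mul hn2v).mono (by push_cast; omega))
  have hav2 : VanishesTo (-m - (n + 1)) a₂ :=
    (hdpv.add ((hm₃.mul hp1v).mono (by push_cast; omega))).add
      ((hm₂.mul hn1v).mono (by push_cast; omega))
  -- Cramer's rule with determinant δ gives L₁; its conjugate is L₂, and Θ is w/δ.
  obtain ⟨g, h, hL1, hL2⟩ : Λ.IsConjPair (ofPoly (Polynomial.C δ⁻¹) * (n₁' * a₁ - p₁' * b₁))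
      (ofPoly (Polynomial.C δ⁻¹) * (n₂' * a₂ - p₂' * b₂)) :=
    (Lattice.IsConjPair.of_poly _).mul ((hn'.mul ha).sub (hp'.mul hb))
  set L₁ := ofPoly (Polynomial.C δ⁻¹) * (n₁' * a₁ - p₁' * b₁) with hL1def
  set L₂ := ofPoly (Polynomial.C δ⁻¹) * (n₂' * a₂ - p₂' * b₂) with hL2def
  have hrel1 : a₁ = L₁ * p₁ + ofPoly (Polynomial.C δ⁻¹ * w) * p₁' := by
    rw [ofPoly_mul, ← hw1, hL1def]
    linear_combination -a₁ * hc - ofPoly (Polynomial.C δ⁻¹) * a₁ * hcas1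
  have hrel1' : b₁ = L₁ * n₁ + ofPoly (Polynomial.C δ⁻¹ * w) * n₁' := by
    rw [ofPoly_mul, ← hw1, hL1def]
    linear_combination -b₁ * hc - ofPoly (Polynomial.C δ⁻¹) * b₁ * hcas1
  have hrel2 : a₂ = L₂ * p₂ + ofPoly (Polynomial.C δ⁻¹ * w) * p₂' := by
    rw [ofPoly_mul, ← hw2, hL2def]
    linear_combination -a₂ * hc - ofPoly (Polynomial.C δ⁻¹) * a₂ * hcas2
  -- Estimating Cramer's numerator termwise would give a bound growing with n; dividing the first
  -- relation by p₁ gives a uniform one.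
  have hLv1 : VanishesTo (-m) L₁ := by
    have e : L₁ = p₁⁻¹ * (a₁ - ofPoly (Polynomial.C δ⁻¹ * w) * p₁') := by
      rw [eq_inv_mul_iff_mul_eq₀ hne1]
      linear_combination -hrel1
    rw [e]
    exact (hpi1.mul (hav1.sub ((hΘv.mul hp1v').mono (by omega)))).mono (by push_cast; omega)
  have hLv2 : VanishesTo (-m) L₂ := by
    have e : L₂ = p₂⁻¹ * (a₂ - ofPoly (Polynomial.C δ⁻¹ * w) * p₂') := by
      rw [eq_inv_mul_iff_mul_eq₀ hne2]
      linear_combination -hrel2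
    rw [e]
    exact (hpi2.mul (hav2.sub ((hΘv.mul hp2v').mono (by omega)))).mono (by push_cast; omega)
  have hhalf := VanishesTo.ofPoly_C (1 / 2)
  -- The sign comes from L₁ = g - Δ_y h. The bounds use g = (L₁ + L₂)/2 and h = (L₂ - L₁)/(2Δ_y).
  refine ⟨g, -h, Polynomial.C δ⁻¹ * w, ⟨?_, ?_, ?_⟩, ?_, ?_⟩
  · rw [← vanishesTo_ofPoly]
    have e : ofPoly g = ofPoly (Polynomial.C (1 / 2)) * (L₁ + L₂) := by
      rw [hL1, hL2]
      linear_combination -ofPoly g * ofPoly_C_half_mul_two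
    rw [e]
    exact (hhalf.mul (hLv1.add hLv2)).mono (by push_cast; omega)
  · rw [natDegree_neg, ← vanishesTo_ofPoly]
    have e : ofPoly h = ofPoly (Polynomial.C (1 / 2)) * (Λ.Δy⁻¹ * (L₂ - L₁)) := by
      rw [hL1, hL2]
      linear_combination -ofPoly h * ofPoly_C_half_mul_two -
        ofPoly (Polynomial.C (1 / 2)) * 2 * ofPoly h * inv_mul_cancel₀ Λ.Δy_ne_zero
    rw [e]
    exact (hhalf.mul (hm₄.mul (hLv2.sub hLv1))).mono (by push_cast; omega)
  · rw [← vanishesTo_ofPoly]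
    exact hΘv.mono (by push_cast; omega)
  · simp only [a₁] at hrel1
    rw [hL1] at hrel1
    rw [ofPoly_neg]
    linear_combination hrel1
  · simp only [b₁] at hrel1'
    rw [hL1] at hrel1'
    rw [ofPoly_neg]
    linear_combination hrel1'

/-- The coefficients in the structure relations may be chosen to extend the initial conditions. -/
theorem exists_structureRelations_initialConditions (hu : RegularMoments u)
    (hP : IsPadeSequence u P N) (hR : Riccati Λ A B C D (stieltjes u)) :
    ∃ l π Θ : ℕ → ℂ[X], UniformlyBoundedDegrees l π Θ ∧ InitialConditions C D l π Θ ∧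
      StructureRelations Λ A B C D P N l π Θ := by
  obtain ⟨m, hm⟩ := exists_structureRelations_of_riccati hu hP hR
  choose l π Θ hdeg h1 h2 using hm
  -- The relations only concern n ≥ 1, so the slot at 0 is free for the initial values.
  refine ⟨fun n => n.casesOn (Polynomial.C (1 / 2) * C) l, fun n => n.casesOn 0 π,
    fun n => n.casesOn D Θ, ⟨m + C.natDegree + D.natDegree, ?_⟩, ⟨rfl, rfl, rfl⟩, ?_⟩
  · rintro (_ | n)
    · refine ⟨(natDegree_C_mul_le _ _).trans (by omega), ?_, by simp⟩
      simp
    · obtain ⟨d1, d2, d3⟩ := hdeg n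
      exact ⟨d1.trans (by omega), d2.trans (by omega), d3.trans (by omega)⟩
  · rintro (_ | n) hn
    · omega
    · exact ⟨h1 n, h2 n⟩

end LaguerreHahn

end

theorem theorem1 (Λ : LaguerreHahn.Lattice) (u : ℕ → ℂ) (hu : LaguerreHahn.RegularMoments u)
    (P N : ℕ → Polynomial ℂ) (hP : LaguerreHahn.IsPadeSequence u P N)
    (A B C D : Polynomial ℂ) :
    List.TFAE
      [LaguerreHahn.Riccati Λ A B C D (LaguerreHahn.stieltjes u),
       ∃ l π Θ : ℕ → Polynomial ℂ, LaguerreHahn.UniformlyBoundedDegrees l π Θ ∧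
         LaguerreHahn.StructureRelations Λ A B C D P N l π Θ,
       ∃ l π Θ : ℕ → Polynomial ℂ, LaguerreHahn.UniformlyBoundedDegrees l π Θ ∧
         LaguerreHahn.InitialConditions C D l π Θ ∧
         LaguerreHahn.SecondKindRelation Λ A B C (LaguerreHahn.stieltjes u)
           (LaguerreHahn.secondKind u P N) l π Θ] ∧
    ∀ l π Θ : ℕ → Polynomial ℂ, LaguerreHahn.UniformlyBoundedDegrees l π Θ →
      LaguerreHahn.InitialConditions C D l π Θ →
      LaguerreHahn.StructureRelations Λ A B C D P N l π Θ →
      LaguerreHahn.SecondKindRelation Λ A B C (LaguerreHahn.stieltjes u)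
        (LaguerreHahn.secondKind u P N) l π Θ := by
  refine ⟨?_, fun l π Θ hdeg hinit h => LaguerreHahn.secondKindRelation_of_riccati hP hinit h
    (LaguerreHahn.riccati_of_structureRelations hu hP hdeg h)⟩
  tfae_have 1 → 3 := by
    intro hR
    obtain ⟨l, π, Θ, hdeg, hinit, h⟩ :=
      LaguerreHahn.exists_structureRelations_initialConditions hu hP hR
    exact ⟨l, π, Θ, hdeg, hinit, LaguerreHahn.secondKindRelation_of_riccati hP hinit h hR⟩
  tfae_have 3 → 1 := by
    rintro ⟨l, π, Θ, -, hinit, h⟩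
    exact LaguerreHahn.riccati_of_secondKindRelation hP hinit h
  tfae_have 1 → 2 := by
    intro hR
    obtain ⟨l, π, Θ, hdeg, -, h⟩ :=
      LaguerreHahn.exists_structureRelations_initialConditions hu hP hR
    exact ⟨l, π, Θ, hdeg, h⟩
  tfae_have 2 → 1 := by
    rintro ⟨l, π, Θ, hdeg, h⟩
    exact LaguerreHahn.riccati_of_structureRelations hu hP hdeg h
  tfae_finish
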